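/- **Setting.** A self-affine sponge in $\mathbb R^d$ is the attractor $F$ of a finite family of maps $f_i(x)=A_ix+t_i$, $i\in\mathcal I=\{1,\dots,N\}$, with $A_i=\operatorname{diag}(\lambda_i^{(1)},\dots,\lambda_i^{(d)})$, $\lambda_i^{(n)}\in(0,1)$, such that $f_i([0,1]^d)\subset[0,1]^d$, $f_i\neq f_j$ for $i\ne j$, and for all coordinates $m\neq n$ some $i$ has $\lambda_i^{(n)}\neq\lambda_i^{(m)}$. For $\mathbf i\in\mathcal I^{\mathbb N}$ and $0<r<1$ let $L_{\mathbf i}(r,n)$ be the unique integer $L\ge1$ with $\prod_{\ell=1}^{L}\lambda_{i_\ell}^{(n)}\le r<\prod_{\ell=1}^{L-1}\lambda_{i_\ell}^{(n)}$. Let $\mathcal A$ be the set of permutations $\sigma=(\sigma_1,\dots,\sigma_d)$ of $\{1,\dots,d\}$ for which there are $\mathbf i$ and $0<r<1$ with $L_{\mathbf i}(r,\sigma_d)\le\dots\le L_{\mathbf i}(r,\sigma_1)$, where in addition, whenever $k<m$ and $L_{\mathbf i}(r,k)=L_{\mathbf i}(r,m)=L$, $k$ precedes $m$ in $\sigma$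 if and only if $\prod_{\ell=1}^{L}\lambda_{i_\ell}^{(k)}\ge\prod_{\ell=1}^{L}\lambda_{i_\ell}^{(m)}$. Let $\mathcal B$ be the set of $\sigma$ for which there are $\mathbf i$ and $0<r<1$ such that, with $K=L_{\mathbf i}(r,\sigma_d)$, $\prod_{\ell=1}^{K}\lambda_{i_\ell}^{(\sigma_d)}<\prod_{\ell=1}^{K}\lambda_{i_\ell}^{(\sigma_{d-1})}<\dots<\prod_{\ell=1}^{K}\lambda_{i_\ell}^{(\sigma_1)}$. Let $\Pi_n^\sigma$ be the orthogonal projection onto the span $E_n^\sigma$ of the coordinate axes $\sigma_1,\dots,\sigma_n$. The maps $f_i,f_j$ overlap exactly on $E_n^\sigma$ if $\Pi_n^\sigma f_i=\Pi_n^\sigma f_j$ on $[0,1]^d$. The sponge satisfies the very strong SPPC (separation of principal projections condition) if for all $\sigma\in\mathcal A$, $1\le n\le d$ and $i,j\in\mathcal I$, either $f_i,f_j$ overlap exactly on $E_n^\sigma$ or $\Pi_n^\sigma(f_i([0,1]^d))\cap\Pi_n^\sigma(f_j([0,1]^d))=\emptyset$. For $0\le n\le d$ let $\mathcal I_n^\sigma\subseteq\mathcal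 I$ consist of the least element of each class of the relation "overlap exactly on $E_n^\sigma$" (a single class if $n=0$), and let $\Pi_n^\sigma j\in\mathcal I_n^\sigma$ be the representative of $j\in\mathcal I$. For a probability vector $\mathbf p=(p(i))_{i\in\mathcal I}$ with positive entries put $p_n^\sigma(i)=\sum_{j:\Pi_n^\sigma j=i}p(j)$, $P_{n-1}^\sigma(i)=p_n^\sigma(i)/p_{n-1}^\sigma(\Pi_{n-1}^\sigma i)$ for $i\in\mathcal I_n^\sigma$, and $$\overline S(\mathbf p,\sigma)=\sum_{n=1}^d\max_{i\in\mathcal I_n^\sigma}\frac{\log P_{n-1}^\sigma(i)}{\log\lambda_i^{(\sigma_n)}}.$$ **Proposition.** There is a sponge in $\mathbb R^4$ generated by two maps $f_1,f_2$ with $$(\lambda_1^{(1)},\dots,\lambda_1^{(4)})=(0.2,\,0.4,\,0.08,\,0.02),\qquad(\lambda_2^{(1)},\dots,\lambda_2^{(4)})=(0.6,\,0.3,\,0.1,\,0.2)$$ which satisfies the very strong SPPC and for which $\mathcal B\subsetneq\mathcal A$. Nonetheless, for every probability vector $\mathbf p=(p(1),p(2))$ with positive entries, both maxima below exist (in particular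 $\mathcal B\ne\emptyset$) and $$\max_{\sigma\in\mathcal B}\overline S(\mathbf p,\sigma)=\max_{\sigma\in\mathcal A}\overline S(\mathbf p,\sigma).$$ -/

import Mathlib

noncomputable section

/-- The diagonal affine map `x ↦ A x + t` of `ℝ^d`, where `A = diag (a 0, …, a (d - 1))`. -/
def diagMap {d : ℕ} (a t : Fin d → ℝ) (x : Fin d → ℝ) : Fin d → ℝ :=
  fun n => a n * x n + t n

/-- The closed unit cube `[0,1]^d`. -/
def unitCube (d : ℕ) : Set (Fin d → ℝ) := Set.Icc 0 1

/-- A self-affine sponge in `ℝ^d`: an iterated function system of `N` maps `f_i` with diagonal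
linear parts, together with its attractor.  Maps and coordinates are indexed from `0`;
`ratio i n` is the contraction ratio of `f_i` in coordinate `n`. -/
structure Sponge (d N : ℕ) where
  /-- diagonal entries of the linear parts -/
  ratio : Fin N → Fin d → ℝ
  /-- translation vectors -/
  trans : Fin N → Fin d → ℝ
  /-- the attractor -/
  carrier : Set (Fin d → ℝ)
  ratio_pos : ∀ i n, 0 < ratio i n
  ratio_lt_one : ∀ i n, ratio i n < 1
  maps_cube : ∀ i, Set.MapsTo (diagMap (ratio i) (trans i)) (unitCube d) (unitCube d)
  /-- no two of the maps coincide -/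
  maps_distinct : ∀ i j, i ≠ j →
    ¬ ∀ x ∈ unitCube d, diagMap (ratio i) (trans i) x = diagMap (ratio j) (trans j) x
  /-- all pairs of coordinates are distinguishable -/
  distinguishable : ∀ m n, m ≠ n → ∃ i, ratio i n ≠ ratio i m
  carrier_nonempty : carrier.Nonempty
  carrier_compact : IsCompact carrier
  carrier_eq : carrier = ⋃ i, diagMap (ratio i) (trans i) '' carrier

namespace Sponge

/-- The `i`-th map of the iterated function system. -/
def map {d N : ℕ} (S : Sponge d N) (i : Fin N) : (Fin d → ℝ) → (Fin d → ℝ) :=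
  diagMap (S.ratio i) (S.trans i)

/-- The orthogonal projection of `ℝ^d` onto the subspace `E_n^σ` spanned by the coordinate axes
with indices `σ_1, …, σ_n`.  (A permutation `σ` lists the coordinates; with indexing from `0`,
the coordinate `k` stands at position `σ.symm k`.) -/
def proj {d : ℕ} (σ : Equiv.Perm (Fin d)) (n : ℕ) (x : Fin d → ℝ) : Fin d → ℝ :=
  fun k => if (σ.symm k : ℕ) < n then x k else 0

/-- `f_i` and `f_j` overlap exactly on `E_n^σ`.  (For `n = 0` this always holds.) -/
def OverlapExactly {d N : ℕ} (S : Sponge d N) (σ : Equiv.Perm (Fin d)) (n : ℕ)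
    (i j : Fin N) : Prop :=
  ∀ x ∈ unitCube d, proj σ n (S.map i x) = proj σ n (S.map j x)

/-- The product of the ratios in coordinate `n` along the first `K` letters of the word `w`. -/
def ratioProd {d N : ℕ} (S : Sponge d N) (w : ℕ → Fin N) (n : Fin d) (K : ℕ) : ℝ :=
  ∏ l ∈ Finset.range K, S.ratio (w l) n

/-- The `r`-stopping `L_w(r, n)` of the word `w` in coordinate `n`, for `0 < r < 1`; see
`stopping_spec` and `stopping_unique` for its defining property. -/
def stopping {d N : ℕ} (S : Sponge d N) (w : ℕ → Fin N) (r : ℝ) (n : Fin d) : ℕ :=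
  sInf {K : ℕ | S.ratioProd w n K ≤ r}

lemma ratioProd_pos {d N : ℕ} (S : Sponge d N) (w : ℕ → Fin N) (n : Fin d) (K : ℕ) :
    0 < S.ratioProd w n K :=
  Finset.prod_pos fun l _ => S.ratio_pos (w l) n

lemma ratioProd_strictAnti {d N : ℕ} (S : Sponge d N) (w : ℕ → Fin N) (n : Fin d) :
    StrictAnti (S.ratioProd w n) := by
  refine strictAnti_nat_of_succ_lt fun K => ?_
  have h := S.ratioProd_pos w n K
  have h1 := S.ratio_lt_one (w K) n
  have h2 : S.ratioProd w n (K + 1) = S.ratioProd w n K * S.ratio (w K) n := by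
    simp [ratioProd, Finset.prod_range_succ]
  rw [h2]
  nlinarith

lemma exists_ratioProd_le {d N : ℕ} (S : Sponge d N) (w : ℕ → Fin N) (n : Fin d) {r : ℝ}
    (hr : 0 < r) : ∃ K, S.ratioProd w n K ≤ r := by
  obtain ⟨i, -, hi⟩ := Finset.exists_max_image Finset.univ (fun i => S.ratio i n)
    ⟨w 0, Finset.mem_univ _⟩
  obtain ⟨K, hK⟩ := exists_pow_lt_of_lt_one hr (S.ratio_lt_one i n)
  refine ⟨K, le_trans ?_ hK.le⟩
  have h := Finset.prod_le_prod (s := Finset.range K) (f := fun l => S.ratio (w l) n)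
    (g := fun _ => S.ratio i n) (fun l _ => (S.ratio_pos _ _).le)
    (fun l _ => hi (w l) (Finset.mem_univ _))
  simpa [ratioProd] using h

lemma stopping_spec {d N : ℕ} (S : Sponge d N) (w : ℕ → Fin N) (n : Fin d) {r : ℝ}
    (hr : 0 < r) (hr1 : r < 1) :
    1 ≤ S.stopping w r n ∧ S.ratioProd w n (S.stopping w r n) ≤ r ∧
      r < S.ratioProd w n (S.stopping w r n - 1) := by
  have hm : S.ratioProd w n (S.stopping w r n) ≤ r :=
    Nat.sInf_mem (s := {K : ℕ | S.ratioProd w n K ≤ r}) (S.exists_ratioProd_le w n hr)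
  have h1 : 1 ≤ S.stopping w r n := by
    by_contra h
    have h0 : S.stopping w r n = 0 := by omega
    rw [h0] at hm
    simp only [ratioProd, Finset.range_zero, Finset.prod_empty] at hm
    linarith
  refine ⟨h1, hm, ?_⟩
  by_contra h
  have h2 : S.stopping w r n ≤ S.stopping w r n - 1 :=
    Nat.sInf_le (s := {K : ℕ | S.ratioProd w n K ≤ r}) (not_lt.mp h)
  omega

lemma stopping_unique {d N : ℕ} (S : Sponge d N) (w : ℕ → Fin N) (n : Fin d) {r : ℝ} {L : ℕ}
    (hL : 1 ≤ L) (h1 : S.ratioProd w n L ≤ r) (h2 : r < S.ratioProd w n (L - 1)) :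
    S.stopping w r n = L := by
  refine le_antisymm (Nat.sInf_le h1) ?_
  by_contra h
  have hm : S.ratioProd w n (S.stopping w r n) ≤ r :=
    Nat.sInf_mem (s := {K : ℕ | S.ratioProd w n K ≤ r}) ⟨L, h1⟩
  have h3 := (S.ratioProd_strictAnti w n).antitone
    (show S.stopping w r n ≤ L - 1 by omega)
  linarith

/-- The word `w` determines a `σ`-ordered cube at scale `r`:
`L_w(r, σ_d) ≤ … ≤ L_w(r, σ_1)`, and coordinates `k < m` with equal stoppings are arranged
according to the size of the products at that stopping (the smaller index first if these agree
as well). -/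
def IsOrderedCube {d N : ℕ} (S : Sponge d N) (σ : Equiv.Perm (Fin d)) (w : ℕ → Fin N)
    (r : ℝ) : Prop :=
  (∀ a b : Fin d, a < b → S.stopping w r (σ b) ≤ S.stopping w r (σ a)) ∧
  ∀ k m : Fin d, k < m → S.stopping w r k = S.stopping w r m →
    (σ.symm k < σ.symm m ↔
      S.ratioProd w m (S.stopping w r k) ≤ S.ratioProd w k (S.stopping w r k))

/-- The word `w` determines a strictly `σ`-ordered cylinder at scale `r`: at the length
`L_w(r, σ_d)` the products are strictly decreasing along `σ_1, …, σ_d`.  (`⊤ : Fin d` is the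
last position.) -/
def IsStrictlyOrderedCylinder {d N : ℕ} [NeZero d] (S : Sponge d N) (σ : Equiv.Perm (Fin d))
    (w : ℕ → Fin N) (r : ℝ) : Prop :=
  ∀ a b : Fin d, a < b →
    S.ratioProd w (σ b) (S.stopping w r (σ ⊤)) < S.ratioProd w (σ a) (S.stopping w r (σ ⊤))

/-- The set `𝒜` of orderings witnessed by cubes. -/
def cubeOrderings {d N : ℕ} (S : Sponge d N) : Set (Equiv.Perm (Fin d)) :=
  {σ | ∃ (w : ℕ → Fin N) (r : ℝ), 0 < r ∧ r < 1 ∧ S.IsOrderedCube σ w r}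

/-- The set `ℬ` of orderings strictly witnessed by cylinders. -/
def cylinderOrderings {d N : ℕ} [NeZero d] (S : Sponge d N) : Set (Equiv.Perm (Fin d)) :=
  {σ | ∃ (w : ℕ → Fin N) (r : ℝ), 0 < r ∧ r < 1 ∧ S.IsStrictlyOrderedCylinder σ w r}

/-- The very strong separation of principal projections condition. -/
def VeryStrongSPPC {d N : ℕ} (S : Sponge d N) : Prop :=
  ∀ σ ∈ S.cubeOrderings, ∀ n : ℕ, 1 ≤ n → n ≤ d → ∀ i j : Fin N,
    S.OverlapExactly σ n i j ∨
      Disjoint (proj σ n '' (S.map i '' unitCube d)) (proj σ n '' (S.map j '' unitCube d))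

open Classical in
/-- The index set `ℐ_n^σ`: an index `j` is removed exactly when some smaller `i` overlaps exactly
with it on `E_n^σ`.  So `ℐ_n^σ` consists of the least elements of the classes of exact overlap;
`ℐ_d^σ` is everything and `ℐ_0^σ` is a single point. -/
def indexSet {d N : ℕ} (S : Sponge d N) (σ : Equiv.Perm (Fin d)) (n : ℕ) : Finset (Fin N) :=
  Finset.univ.filter fun j => ∀ i < j, ¬ S.OverlapExactly σ n i j

lemma indexSet_nonempty {d N : ℕ} [NeZero N] (S : Sponge d N) (σ : Equiv.Perm (Fin d)) (n : ℕ) :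
    (S.indexSet σ n).Nonempty :=
  ⟨0, by simp [indexSet]⟩

lemma overlapExactly_filter_nonempty {d N : ℕ} (S : Sponge d N) (σ : Equiv.Perm (Fin d)) (n : ℕ)
    (j : Fin N) [DecidablePred fun i => S.OverlapExactly σ n i j] :
    (Finset.univ.filter fun i => S.OverlapExactly σ n i j).Nonempty :=
  ⟨j, Finset.mem_filter.mpr ⟨Finset.mem_univ _, fun _ _ => rfl⟩⟩

open Classical in
/-- The projection `Π_n^σ : ℐ → ℐ_n^σ`; see `projIndex_eq_iff`. -/
def projIndex {d N : ℕ} (S : Sponge d N) (σ : Equiv.Perm (Fin d)) (n : ℕ) (j : Fin N) : Fin N :=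
  (Finset.univ.filter fun i => S.OverlapExactly σ n i j).min'
    (S.overlapExactly_filter_nonempty σ n j)

lemma projIndex_eq_iff {d N : ℕ} (S : Sponge d N) (σ : Equiv.Perm (Fin d)) (n : ℕ)
    (i j : Fin N) :
    S.projIndex σ n j = i ↔ S.OverlapExactly σ n i j ∧ i ∈ S.indexSet σ n := by
  classical
  have key : ∀ k : Fin N, S.OverlapExactly σ n k j → S.projIndex σ n j ≤ k := fun k hk =>
    Finset.min'_le _ _ (by simpa using hk)
  have hm : S.OverlapExactly σ n (S.projIndex σ n j) j := by
    have h := Finset.min'_mem (Finset.univ.filter fun i => S.OverlapExactly σ n i j)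
      (S.overlapExactly_filter_nonempty σ n j)
    simpa [projIndex] using h
  constructor
  · rintro rfl
    refine ⟨hm, ?_⟩
    simp only [indexSet, Finset.mem_filter, Finset.mem_univ, true_and]
    intro k hk hko
    exact absurd (key k fun x hx => (hko x hx).trans (hm x hx)) (not_le.mpr hk)
  · rintro ⟨h1, h2⟩
    simp only [indexSet, Finset.mem_filter, Finset.mem_univ, true_and] at h2
    refine le_antisymm (key i h1) ?_
    by_contra h
    exact h2 _ (not_le.mp h) fun x hx => (hm x hx).trans (h1 x hx).symm

open Classical in
/-- The projected weight `p_n^σ(i) = ∑_{j : Π_n^σ j = i} p(j)`.  For `n = 0` and a probability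
vector `p` it equals `1` at the only element of `ℐ_0^σ`. -/
def projWeight {d N : ℕ} (S : Sponge d N) (σ : Equiv.Perm (Fin d)) (p : Fin N → ℝ) (n : ℕ)
    (i : Fin N) : ℝ :=
  ∑ j ∈ Finset.univ.filter (fun j => S.projIndex σ n j = i), p j

/-- The conditional weight `P_{n-1}^σ(i) = p_n^σ(i) / p_{n-1}^σ(Π_{n-1}^σ i)` with `n = k + 1`. -/
def condWeight {d N : ℕ} (S : Sponge d N) (σ : Equiv.Perm (Fin d)) (p : Fin N → ℝ) (k : ℕ)
    (i : Fin N) : ℝ :=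
  S.projWeight σ p (k + 1) i / S.projWeight σ p k (S.projIndex σ k i)

/-- `S̄(p, σ) = ∑_{n=1}^d max_{i ∈ ℐ_n^σ} log P_{n-1}^σ(i) / log λ_i^{(σ_n)}`, with `n = k + 1`. -/
def upperS {d N : ℕ} [NeZero N] (S : Sponge d N) (p : Fin N → ℝ) (σ : Equiv.Perm (Fin d)) : ℝ :=
  ∑ k : Fin d, (S.indexSet σ (k + 1)).sup' (S.indexSet_nonempty σ (k + 1))
    fun i => Real.log (S.condWeight σ p k i) / Real.log (S.ratio i (σ k))

end Sponge

end

/-! The first map fixes the origin and the second the opposite corner. In each coordinate the two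
ratios sum to less than 1, so the images of the cube are disjoint after every nontrivial coordinate
projection (`example_map_lt`). This gives the very strong SPPC with no exact overlaps, so every
conditional weight beyond the first coordinate is 1 and `S̄(p, σ)` depends on `σ` only through `σ_1`
(`upperS_eq_of_forall_not_overlap`).

Coordinates 3 and 4 are dominated by coordinate 2, so `σ_1` is 1 or 2 for every cube ordering. The
one-letter cylinders realise (1,2,4,3) and (2,1,3,4), so both first coordinates already occur in
`ℬ`, and the maxima agree.

For strictness, take a cylinder with letter counts `a` and `b`. Its products in coordinates 1 and 2
have quotient `2^(b-a)`, those in coordinates 4 and 3 have quotient `2^(b-2a)`. If 2 precedes 1,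
then `b < a`, hence `b < 2a` and 3 precedes 4; so (2,1,4,3) is not in `ℬ`. A cube compares
coordinates at different lengths and escapes this constraint. -/

noncomputable section

namespace Sponge

open Set

/-! ### Existence of the attractor through the coding map -/

section Attractor

variable {d N : ℕ} (a t : Fin N → Fin d → ℝ)

/-- The point of the attractor of the maps `x ↦ diag (a i) x + t i` with address `w`. -/
def codingMap (w : ℕ → Fin N) (n : Fin d) : ℝ :=
  ∑' l, (∏ j ∈ Finset.range l, a (w j) n) * t (w l) n

variable {a t} {c C : ℝ}

/-- The geometric bound is uniform in the word, so it yields both convergence of the coding series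
and continuity in `w`. -/
lemma abs_codingTerm_le (ha0 : ∀ i n, 0 ≤ a i n) (hac : ∀ i n, a i n ≤ c)
    (ht : ∀ i n, |t i n| ≤ C) (hc0 : 0 ≤ c) (w : ℕ → Fin N) (n : Fin d) (l : ℕ) :
    ‖(∏ j ∈ Finset.range l, a (w j) n) * t (w l) n‖ ≤ c ^ l * C := by
  have h0 : 0 ≤ ∏ j ∈ Finset.range l, a (w j) n := Finset.prod_nonneg fun j _ => ha0 _ _
  have h1 : ∏ j ∈ Finset.range l, a (w j) n ≤ c ^ l := by
    simpa using Finset.prod_le_prod (s := Finset.range l) (f := fun j => a (w j) n)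
      (g := fun _ => c) (fun j _ => ha0 _ _) fun j _ => hac _ _
  rw [norm_mul, Real.norm_eq_abs, Real.norm_eq_abs, abs_of_nonneg h0]
  exact mul_le_mul h1 (ht _ _) (abs_nonneg _) (pow_nonneg hc0 _)

lemma codingMap_eq (ha0 : ∀ i n, 0 ≤ a i n) (hac : ∀ i n, a i n ≤ c)
    (ht : ∀ i n, |t i n| ≤ C) (hc0 : 0 ≤ c) (hc1 : c < 1) (w : ℕ → Fin N) :
    codingMap a t w = diagMap (a (w 0)) (t (w 0)) (codingMap a t fun l => w (l + 1)) := by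
  funext n
  have hs : Summable fun l => (∏ j ∈ Finset.range l, a (w j) n) * t (w l) n :=
    Summable.of_norm_bounded ((summable_geometric_of_lt_one hc0 hc1).mul_right C)
      (abs_codingTerm_le ha0 hac ht hc0 w n)
  simp only [codingMap, diagMap]
  rw [hs.tsum_eq_zero_add, ← tsum_mul_left, add_comm]
  simp [Finset.prod_range_succ', mul_comm, mul_left_comm]

lemma continuous_codingMap (ha0 : ∀ i n, 0 ≤ a i n) (hac : ∀ i n, a i n ≤ c)
    (ht : ∀ i n, |t i n| ≤ C) (hc0 : 0 ≤ c) (hc1 : c < 1) : Continuous (codingMap a t) := by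
  refine continuous_pi fun n => ?_
  refine continuous_tsum (fun l => ?_) ((summable_geometric_of_lt_one hc0 hc1).mul_right C)
    fun l w => abs_codingTerm_le ha0 hac ht hc0 w n l
  refine Continuous.mul (continuous_finsetProd _ fun j _ => ?_) ?_
  · exact (continuous_of_discreteTopology (f := fun i => a i n)).comp (continuous_apply j)
  · exact (continuous_of_discreteTopology (f := fun i => t i n)).comp (continuous_apply l)

lemma range_codingMap_eq (ha0 : ∀ i n, 0 ≤ a i n) (hac : ∀ i n, a i n ≤ c)
    (ht : ∀ i n, |t i n| ≤ C) (hc0 : 0 ≤ c) (hc1 : c < 1) :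
    range (codingMap a t) = ⋃ i, diagMap (a i) (t i) '' range (codingMap a t) := by
  ext x
  simp only [mem_iUnion, mem_image, mem_range, exists_exists_eq_and]
  constructor
  · rintro ⟨w, rfl⟩
    exact ⟨w 0, _, (codingMap_eq ha0 hac ht hc0 hc1 w).symm⟩
  · rintro ⟨i, w, rfl⟩
    -- Applying the map `i` prepends the letter `i` to the address.
    exact ⟨fun l => Nat.casesOn l i w, codingMap_eq ha0 hac ht hc0 hc1 _⟩

end Attractor

/-! ### Dominated coordinates, sponges without overlaps, products over two letters -/

section General

variable {d N : ℕ} (S : Sponge d N)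

lemma ratioProd_lt {m n : Fin d} (h : ∀ i, S.ratio i m < S.ratio i n) (w : ℕ → Fin N) {K : ℕ}
    (hK : 1 ≤ K) : S.ratioProd w m K < S.ratioProd w n K :=
  Finset.prod_lt_prod_of_nonempty (fun _ _ => S.ratio_pos _ _) (fun _ _ => h _)
    ⟨0, Finset.mem_range.mpr hK⟩

lemma stopping_le_of_ratio_lt {m n : Fin d} (h : ∀ i, S.ratio i m < S.ratio i n)
    (w : ℕ → Fin N) {r : ℝ} (hr : 0 < r) (hr1 : r < 1) :
    S.stopping w r m ≤ S.stopping w r n := by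
  obtain ⟨h1, h2, -⟩ := S.stopping_spec w n hr hr1
  exact Nat.sInf_le ((S.ratioProd_lt h w h1).le.trans h2)

/-- A coordinate dominated by another one cannot come first in the ordering of a cube. -/
lemma IsOrderedCube.apply_zero_ne {d N : ℕ} {S : Sponge (d + 1) N}
    {σ : Equiv.Perm (Fin (d + 1))} {w : ℕ → Fin N} {r : ℝ} (h : S.IsOrderedCube σ w r)
    (hr : 0 < r) (hr1 : r < 1) {k m : Fin (d + 1)} (hkm : k < m)
    (hlt : ∀ i, S.ratio i m < S.ratio i k) : σ 0 ≠ m := by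
  rintro rfl
  have hpos : (0 : Fin (d + 1)) < σ.symm k := by
    refine Fin.pos_iff_ne_zero.mpr fun h0 => hkm.ne ?_
    rw [← h0, Equiv.apply_symm_apply]
  have h1 := h.1 _ _ hpos
  rw [Equiv.apply_symm_apply] at h1
  -- In first place `m` has the largest stopping, while domination makes it at most that of `k`.
  -- They tie, and the tie-break puts `k` ahead of position 0.
  have h2 := h1.antisymm (S.stopping_le_of_ratio_lt hlt w hr hr1)
  have h3 := (h.2 _ _ hkm h2).mpr (S.ratioProd_lt hlt w (S.stopping_spec w k hr hr1).1).le
  rw [Equiv.symm_apply_apply] at h3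
  exact absurd h3 (Fin.not_lt_zero _)

lemma indexSet_eq_univ {σ : Equiv.Perm (Fin d)} {n : ℕ}
    (h : ∀ i j, S.OverlapExactly σ n i j → i = j) : S.indexSet σ n = Finset.univ := by
  ext j
  simp only [indexSet, Finset.mem_filter, Finset.mem_univ, true_and, iff_true]
  exact fun i hi ho => hi.ne (h _ _ ho)

lemma projIndex_eq_self {σ : Equiv.Perm (Fin d)} {n : ℕ}
    (h : ∀ i j, S.OverlapExactly σ n i j → i = j) (j : Fin N) : S.projIndex σ n j = j :=
  h _ _ ((S.projIndex_eq_iff σ n _ j).mp rfl).1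

lemma projWeight_eq_self {σ : Equiv.Perm (Fin d)} {n : ℕ}
    (h : ∀ i j, S.OverlapExactly σ n i j → i = j) (p : Fin N → ℝ) (i : Fin N) :
    S.projWeight σ p n i = p i := by
  simp [projWeight, S.projIndex_eq_self h, Finset.filter_eq']

lemma projIndex_zero (σ : Equiv.Perm (Fin d)) (i j : Fin N) :
    S.projIndex σ 0 j = S.projIndex σ 0 i := by
  refine (S.projIndex_eq_iff σ 0 _ j).mpr ⟨fun x _ => ?_, ((S.projIndex_eq_iff σ 0 _ i).mp rfl).2⟩
  funext k
  simp [proj]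

lemma projWeight_zero (σ : Equiv.Perm (Fin d)) (p : Fin N → ℝ) (i : Fin N) :
    S.projWeight σ p 0 (S.projIndex σ 0 i) = ∑ j, p j := by
  rw [projWeight, Finset.filter_true_of_mem fun j _ => S.projIndex_zero σ i j]

/-- If no two maps overlap exactly on any nontrivial projection, only the first coordinate
contributes to `S̄(p, σ)`. -/
lemma upperS_eq_of_forall_not_overlap {d N : ℕ} [NeZero N] (S : Sponge (d + 1) N)
    {σ : Equiv.Perm (Fin (d + 1))}
    (h : ∀ n, 1 ≤ n → ∀ i j, S.OverlapExactly σ n i j → i = j) {p : Fin N → ℝ}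
    (hp : ∀ i, 0 < p i) (hp1 : ∑ i, p i = 1) :
    S.upperS p σ = Finset.univ.sup' Finset.univ_nonempty
      fun i => Real.log (p i) / Real.log (S.ratio i (σ 0)) := by
  rw [upperS, Fin.sum_univ_succ, Finset.sum_eq_zero, add_zero]
  · refine Finset.sup'_congr _ (S.indexSet_eq_univ (h _ (by simp))) fun i _ => ?_
    simp only [condWeight, Fin.val_zero, S.projWeight_zero, hp1, div_one,
      S.projWeight_eq_self (h _ (show 1 ≤ 0 + 1 by simp))]
  -- From the second coordinate on, both projections of indices are the identity, so the conditional
  -- weight is `p i / p i`.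
  · intro k _
    refine (Finset.sup'_congr (g := fun _ => (0 : ℝ)) _ rfl fun i _ => ?_).trans
      (Finset.sup'_const _ _)
    rw [condWeight, S.projWeight_eq_self (h _ (by simp)),
      S.projIndex_eq_self (h _ (by simp)), S.projWeight_eq_self (h _ (by simp)),
      div_self (hp i).ne', Real.log_one, zero_div]

/-- Two permutations sorting the same family strictly agree. -/
lemma perm_eq_of_strictAnti {f : Fin d → ℝ} {σ τ : Equiv.Perm (Fin d)}
    (hσ : StrictAnti (f ∘ σ)) (hτ : StrictAnti (f ∘ τ)) : σ = τ := by
  have hf : Function.Injective f := by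
    intro x y hxy
    have := hσ.injective (a₁ := σ.symm x) (a₂ := σ.symm y) (by simpa using hxy)
    simpa using this
  -- An increasing bijection of `Fin d` is the identity.
  have hmono : StrictMono (fun x => τ.symm (σ x)) := by
    intro x y hxy
    by_contra hle
    have h1 := hτ.antitone (not_lt.mp hle)
    have h2 := hσ hxy
    simp only [Function.comp_apply, Equiv.apply_symm_apply] at h1 h2
    exact absurd h2 (not_lt.mpr h1)
  have hid : (fun x => τ.symm (σ x)) = id := by
    refine StrictMono.range_inj hmono strictMono_id |>.mp ?_
    rw [range_id]
    exact ((σ.trans τ.symm).surjective).range_eq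
  ext x
  have := congrFun hid x
  simp only [id] at this
  rw [← τ.symm_apply_eq.mp this]

/-- The exponents count the letters, so one pair serves all coordinates at once. -/
lemma exists_ratioProd_eq_pow (S : Sponge d 2) (w : ℕ → Fin 2) (K : ℕ) :
    ∃ a b : ℕ, ∀ n, S.ratioProd w n K = S.ratio 0 n ^ a * S.ratio 1 n ^ b := by
  induction K with
  | zero => exact ⟨0, 0, fun n => by simp [ratioProd]⟩
  | succ K ih =>
    obtain ⟨a, b, h⟩ := ih
    have hs : ∀ n, S.ratioProd w n (K + 1) = S.ratioProd w n K * S.ratio (w K) n := fun n => by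
      simp [ratioProd, Finset.prod_range_succ]
    rcases Fin.exists_fin_two.mp ⟨w K, rfl⟩ with hw | hw
    · exact ⟨a + 1, b, fun n => by rw [hs, h, ← hw]; ring⟩
    · exact ⟨a, b + 1, fun n => by rw [hs, h, ← hw]; ring⟩

end General

/-! ### The sponge and its separation -/

section Example

/-- The contraction ratios of the example. -/
def exampleRatio : Fin 2 → Fin 4 → ℝ := ![![0.2, 0.4, 0.08, 0.02], ![0.6, 0.3, 0.1, 0.2]]

/-- The first map fixes the origin, the second one fixes the opposite corner of the cube. -/
def exampleTrans : Fin 2 → Fin 4 → ℝ := ![0, fun n => 1 - exampleRatio 1 n]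

lemma exampleRatio_pos (i : Fin 2) (n : Fin 4) : 0 < exampleRatio i n := by
  fin_cases i <;> fin_cases n <;> norm_num [exampleRatio]

lemma exampleRatio_le (i : Fin 2) (n : Fin 4) : exampleRatio i n ≤ 0.6 := by
  fin_cases i <;> fin_cases n <;> norm_num [exampleRatio]

lemma exampleTrans_nonneg (i : Fin 2) (n : Fin 4) : 0 ≤ exampleTrans i n := by
  fin_cases i <;> fin_cases n <;> norm_num [exampleTrans, exampleRatio]

lemma exampleRatio_add_exampleTrans_le (i : Fin 2) (n : Fin 4) :
    exampleRatio i n + exampleTrans i n ≤ 1 := by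
  fin_cases i <;> fin_cases n <;> norm_num [exampleTrans, exampleRatio]

lemma abs_exampleTrans_le (i : Fin 2) (n : Fin 4) : |exampleTrans i n| ≤ 1 := by
  rw [abs_of_nonneg (exampleTrans_nonneg i n)]
  linarith [exampleRatio_pos i n, exampleRatio_add_exampleTrans_le i n]

/-- In coordinate `n` the images of the cube are `[0, λ_1]` and `[1 - λ_2, 1]`, which are disjoint
because `λ_1 + λ_2 < 1`. -/
lemma example_map_lt {x y : Fin 4 → ℝ} (hx : x ∈ unitCube 4) (hy : y ∈ unitCube 4) (n : Fin 4) :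
    diagMap (exampleRatio 0) (exampleTrans 0) x n <
      diagMap (exampleRatio 1) (exampleTrans 1) y n := by
  have h1 : x n ≤ 1 := hx.2 n
  have h2 : 0 ≤ y n := hy.1 n
  have h3 : exampleRatio 0 n + exampleRatio 1 n < 1 := by
    fin_cases n <;> norm_num [exampleRatio]
  have h4 : exampleTrans 0 n = 0 := by simp [exampleTrans]
  have h5 : exampleTrans 1 n = 1 - exampleRatio 1 n := by simp [exampleTrans]
  simp only [diagMap, h4, h5]
  nlinarith [exampleRatio_pos 0 n, exampleRatio_pos 1 n]

/-- The sponge in `ℝ⁴` of the example. -/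
def exampleSponge : Sponge 4 2 where
  ratio := exampleRatio
  trans := exampleTrans
  carrier := range (codingMap exampleRatio exampleTrans)
  ratio_pos := exampleRatio_pos
  ratio_lt_one i n := (exampleRatio_le i n).trans_lt (by norm_num)
  maps_cube i x hx := by
    refine ⟨fun n => ?_, fun n => ?_⟩
    · exact add_nonneg (mul_nonneg (exampleRatio_pos i n).le (hx.1 n)) (exampleTrans_nonneg i n)
    · have h1 : x n ≤ 1 := hx.2 n
      change exampleRatio i n * x n + exampleTrans i n ≤ 1
      nlinarith [exampleRatio_pos i n, exampleRatio_add_exampleTrans_le i n]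
  maps_distinct i j hij h := by
    have h0 : (0 : Fin 4 → ℝ) ∈ unitCube 4 := ⟨le_rfl, zero_le_one⟩
    have hlt := example_map_lt h0 h0 0
    have he := congrFun (h 0 h0) 0
    fin_cases i <;> fin_cases j
    · exact hij rfl
    · exact hlt.ne he
    · exact hlt.ne he.symm
    · exact hij rfl
  distinguishable m n hmn := by
    refine ⟨0, ?_⟩
    fin_cases m <;> fin_cases n <;> first | exact absurd rfl hmn | norm_num [exampleRatio]
  carrier_nonempty := ⟨_, fun _ => 0, rfl⟩
  carrier_compact := isCompact_range <| continuous_codingMap (fun i n => (exampleRatio_pos i n).le)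
    exampleRatio_le abs_exampleTrans_le (by norm_num) (by norm_num)
  carrier_eq := range_codingMap_eq (fun i n => (exampleRatio_pos i n).le)
    exampleRatio_le abs_exampleTrans_le (by norm_num) (by norm_num)

lemma exampleSponge_ratio : exampleSponge.ratio = exampleRatio := rfl

lemma exampleSponge_disjoint (σ : Equiv.Perm (Fin 4)) {n : ℕ} (hn : 1 ≤ n) {i j : Fin 2}
    (hij : i ≠ j) : Disjoint (proj σ n '' (exampleSponge.map i '' unitCube 4))
      (proj σ n '' (exampleSponge.map j '' unitCube 4)) := by
  rw [Set.disjoint_left]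
  rintro _ ⟨_, ⟨x, hx, rfl⟩, rfl⟩ ⟨_, ⟨y, hy, rfl⟩, h⟩
  have h0 := congrFun h (σ 0)
  -- The coordinate `σ 0` survives every projection with `n ≥ 1`.
  simp only [proj, Equiv.symm_apply_apply, Fin.val_zero, if_pos (Nat.lt_of_succ_le hn)] at h0
  fin_cases i <;> fin_cases j
  · exact hij rfl
  · exact (example_map_lt hx hy _).ne h0.symm
  · exact (example_map_lt hy hx _).ne h0
  · exact hij rfl

lemma exampleSponge_eq_of_overlap (σ : Equiv.Perm (Fin 4)) (n : ℕ) (hn : 1 ≤ n) (i j : Fin 2)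
    (h : exampleSponge.OverlapExactly σ n i j) : i = j := by
  by_contra hij
  have h0 : (0 : Fin 4 → ℝ) ∈ unitCube 4 := ⟨le_rfl, zero_le_one⟩
  refine Set.disjoint_left.mp (exampleSponge_disjoint σ hn hij) (mem_image_of_mem _
    (mem_image_of_mem _ h0)) ?_
  rw [h 0 h0]
  exact mem_image_of_mem _ (mem_image_of_mem _ h0)

lemma exampleSponge_veryStrongSPPC : exampleSponge.VeryStrongSPPC := by
  intro σ _ n hn _ i j
  by_cases hij : i = j
  · exact Or.inl (hij ▸ fun _ _ => rfl)
  · exact Or.inr (exampleSponge_disjoint σ hn hij)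

/-! ### Orderings realisable by cylinders -/

/-- The ordering `(1, 2, 4, 3)` of the coordinates. -/
def perm1243 : Equiv.Perm (Fin 4) := Equiv.swap 2 3

/-- The ordering `(2, 1, 3, 4)` of the coordinates. -/
def perm2134 : Equiv.Perm (Fin 4) := Equiv.swap 0 1

/-- The ordering `(2, 1, 4, 3)` of the coordinates. -/
def perm2143 : Equiv.Perm (Fin 4) := Equiv.swap 0 1 * Equiv.swap 2 3

lemma coe_perm1243 : ⇑perm1243 = ![0, 1, 3, 2] := by decide

lemma coe_perm2134 : ⇑perm2134 = ![1, 0, 2, 3] := by decide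

lemma coe_perm2143 : ⇑perm2143 = ![1, 0, 3, 2] := by decide

lemma coe_perm1243_symm : ⇑perm1243.symm = ![0, 1, 3, 2] := by decide

lemma coe_perm2134_symm : ⇑perm2134.symm = ![1, 0, 2, 3] := by decide

lemma coe_perm2143_symm : ⇑perm2143.symm = ![1, 0, 3, 2] := by decide

/-- At scale `0.7` every coordinate therefore stops at the first letter. -/
lemma exampleSponge_ratio_le (i : Fin 2) (n : Fin 4) : exampleSponge.ratio i n ≤ 0.7 :=
  (exampleRatio_le i n).trans (by norm_num)

lemma exampleSponge_ratio_two_lt_zero (i : Fin 2) :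
    exampleSponge.ratio i 2 < exampleSponge.ratio i 0 := by
  change exampleRatio i 2 < exampleRatio i 0
  fin_cases i <;> simp [exampleRatio] <;> norm_num

lemma exampleSponge_ratio_two_lt_one (i : Fin 2) :
    exampleSponge.ratio i 2 < exampleSponge.ratio i 1 := by
  change exampleRatio i 2 < exampleRatio i 1
  fin_cases i <;> simp [exampleRatio] <;> norm_num

lemma exampleSponge_ratio_three_lt_one (i : Fin 2) :
    exampleSponge.ratio i 3 < exampleSponge.ratio i 1 := by
  change exampleRatio i 3 < exampleRatio i 1
  fin_cases i <;> simp [exampleRatio] <;> norm_num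

/-- The order of the first two, and that of the last two products, depend only on the letter
counts `a` and `b` of the cylinder. -/
lemma exampleSponge_ratioProd_relations (w : ℕ → Fin 2) (K : ℕ) : ∃ a b : ℕ,
    exampleSponge.ratioProd w 0 K * 2 ^ a = exampleSponge.ratioProd w 1 K * 2 ^ b ∧
      exampleSponge.ratioProd w 3 K * 2 ^ (2 * a) = exampleSponge.ratioProd w 2 K * 2 ^ b := by
  obtain ⟨a, b, h⟩ := exampleSponge.exists_ratioProd_eq_pow w K
  refine ⟨a, b, ?_, ?_⟩
  -- The ratios are chosen so that the relevant quotients are powers of 2: 0.4/0.2, 0.6/0.3 and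
  -- 0.2/0.1 equal 2, and 0.08/0.02 equals 4.
  · have h1 : (0.4 : ℝ) ^ a = 0.2 ^ a * 2 ^ a := by rw [← mul_pow]; norm_num
    have h2 : (0.6 : ℝ) ^ b = 0.3 ^ b * 2 ^ b := by rw [← mul_pow]; norm_num
    simp [h, exampleSponge_ratio, exampleRatio, h1, h2]
    ring
  · have h1 : (0.08 : ℝ) ^ a = 0.02 ^ a * 2 ^ (2 * a) := by rw [pow_mul, ← mul_pow]; norm_num
    have h2 : (0.2 : ℝ) ^ b = 0.1 ^ b * 2 ^ b := by rw [← mul_pow]; norm_num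
    simp [h, exampleSponge_ratio, exampleRatio, h1, h2]
    ring

lemma lt_iff_of_mul_two_pow_eq {x y : ℝ} (hy : 0 < y) {a b : ℕ}
    (h : x * 2 ^ a = y * 2 ^ b) : x < y ↔ b < a := by
  rw [← pow_lt_pow_iff_right₀ (one_lt_two : (1 : ℝ) < 2)]
  have ha : (0 : ℝ) < 2 ^ a := by positivity
  have hb : (0 : ℝ) < 2 ^ b := by positivity
  constructor <;> intro hlt <;> by_contra hle <;> nlinarith

/-- The hypothesis amounts to `b < a`, the conclusion to `b < 2 * a`. This is the obstruction that
keeps `perm2143` out of `ℬ`. -/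
lemma exampleSponge_products_not_reversed (w : ℕ → Fin 2) (K : ℕ)
    (h : exampleSponge.ratioProd w 0 K < exampleSponge.ratioProd w 1 K) :
    exampleSponge.ratioProd w 3 K < exampleSponge.ratioProd w 2 K := by
  obtain ⟨a, b, h1, h2⟩ := exampleSponge_ratioProd_relations w K
  have hpos := fun n => exampleSponge.ratioProd_pos w n K
  rw [lt_iff_of_mul_two_pow_eq (hpos _) h1] at h
  rw [lt_iff_of_mul_two_pow_eq (hpos _) h2]
  omega

lemma perm_mem_of_mem_cylinderOrderings {σ : Equiv.Perm (Fin 4)}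
    (hσ : σ ∈ exampleSponge.cylinderOrderings) : σ = 1 ∨ σ = perm1243 ∨ σ = perm2134 := by
  obtain ⟨w, r, hr, hr1, h⟩ := hσ
  obtain ⟨hK, -, -⟩ := exampleSponge.stopping_spec w (σ ⊤) hr hr1
  unfold IsStrictlyOrderedCylinder at h
  generalize exampleSponge.stopping w r (σ ⊤) = K at h hK
  set f : Fin 4 → ℝ := fun n => exampleSponge.ratioProd w n K
  have hanti : StrictAnti (f ∘ σ) := fun a b hab => h a b hab
  have hinj : ∀ m n, m ≠ n → f m ≠ f n := by
    intro m n hmn he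
    have := hanti.injective (a₁ := σ.symm m) (a₂ := σ.symm n) (by simpa using he)
    exact hmn (by simpa using this)
  have h20 : f 2 < f 0 := exampleSponge.ratioProd_lt exampleSponge_ratio_two_lt_zero w hK
  have h21 : f 2 < f 1 := exampleSponge.ratioProd_lt exampleSponge_ratio_two_lt_one w hK
  have h31 : f 3 < f 1 := exampleSponge.ratioProd_lt exampleSponge_ratio_three_lt_one w hK
  -- Only the comparisons of `f 0` with `f 1` and of `f 3` with `f 2` remain free, and `hrev`
  -- excludes one of their four outcomes.
  have hrev : f 0 < f 1 → f 3 < f 2 := exampleSponge_products_not_reversed w K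
  rcases lt_or_gt_of_ne (hinj 0 1 (by decide)) with h01 | h01
  · refine Or.inr (Or.inr (perm_eq_of_strictAnti hanti (Fin.strictAnti_iff_succ_lt.mpr ?_)))
    have h32 := hrev h01
    intro i
    fin_cases i <;> simpa [coe_perm2134]
  · rcases lt_or_gt_of_ne (hinj 3 2 (by decide)) with h32 | h32
    · refine Or.inl (perm_eq_of_strictAnti hanti (Fin.strictAnti_iff_succ_lt.mpr ?_))
      intro i
      fin_cases i <;> simpa
    · refine Or.inr (Or.inl (perm_eq_of_strictAnti hanti (Fin.strictAnti_iff_succ_lt.mpr ?_)))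
      intro i
      fin_cases i <;> simpa [coe_perm1243]

/-! ### Witnesses for cylinder and cube orderings -/

/-- The word `i j j j …`. -/
def headTailWord (i j : Fin 2) : ℕ → Fin 2 := fun l => if l = 0 then i else j

lemma ratioProd_headTailWord {d : ℕ} (S : Sponge d 2) (i j : Fin 2) (n : Fin d) (K : ℕ) :
    S.ratioProd (headTailWord i j) n (K + 1) = S.ratio j n ^ K * S.ratio i n := by
  simp [ratioProd, headTailWord, Finset.prod_range_succ']

lemma stopping_headTailWord {d : ℕ} (S : Sponge d 2) (i j : Fin 2) (n : Fin d) {r : ℝ} {K : ℕ}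
    (h1 : S.ratio j n ^ (K + 1) * S.ratio i n ≤ r) (h2 : r < S.ratio j n ^ K * S.ratio i n) :
    S.stopping (headTailWord i j) r n = K + 2 :=
  S.stopping_unique _ _ (by omega) (by rwa [ratioProd_headTailWord])
    (by rwa [show K + 2 - 1 = K + 1 from rfl, ratioProd_headTailWord])

lemma stopping_headTailWord_one {d : ℕ} (S : Sponge d 2) (i j : Fin 2) (n : Fin d) {r : ℝ}
    (h1 : S.ratio i n ≤ r) (hr1 : r < 1) : S.stopping (headTailWord i j) r n = 1 :=
  S.stopping_unique _ _ le_rfl (by simpa [ratioProd, headTailWord] using h1)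
    (by simpa [ratioProd] using hr1)

lemma perm1243_mem_cylinderOrderings : perm1243 ∈ exampleSponge.cylinderOrderings := by
  -- One letter of the second map: 0.6 > 0.3 > 0.2 > 0.1 in the order 1, 2, 4, 3.
  refine ⟨headTailWord 1 1, 0.7, by norm_num, by norm_num, ?_⟩
  have hL : ∀ n, exampleSponge.stopping (headTailWord 1 1) 0.7 n = 0 + 1 := fun n =>
    stopping_headTailWord_one _ _ _ _ (exampleSponge_ratio_le _ _) (by norm_num)
  intro a b hab
  rw [hL, ratioProd_headTailWord, ratioProd_headTailWord, coe_perm1243, exampleSponge_ratio]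
  fin_cases a <;> fin_cases b <;> first
    | exact absurd hab (by decide)
    | (simp [exampleRatio]; norm_num)

lemma perm2134_mem_cylinderOrderings : perm2134 ∈ exampleSponge.cylinderOrderings := by
  -- One letter of the first map: 0.4 > 0.2 > 0.08 > 0.02 in the order 2, 1, 3, 4.
  refine ⟨headTailWord 0 0, 0.7, by norm_num, by norm_num, ?_⟩
  have hL : ∀ n, exampleSponge.stopping (headTailWord 0 0) 0.7 n = 0 + 1 := fun n =>
    stopping_headTailWord_one _ _ _ _ (exampleSponge_ratio_le _ _) (by norm_num)
  intro a b hab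
  rw [hL, ratioProd_headTailWord, ratioProd_headTailWord, coe_perm2134, exampleSponge_ratio]
  fin_cases a <;> fin_cases b <;> first
    | exact absurd hab (by decide)
    | (simp [exampleRatio]; norm_num)

lemma perm1243_mem_cubeOrderings : perm1243 ∈ exampleSponge.cubeOrderings := by
  refine ⟨headTailWord 1 1, 0.7, by norm_num, by norm_num, ?_⟩
  have hL : ∀ n, exampleSponge.stopping (headTailWord 1 1) 0.7 n = 0 + 1 := fun n =>
    stopping_headTailWord_one _ _ _ _ (exampleSponge_ratio_le _ _) (by norm_num)
  refine ⟨fun a b _ => by rw [hL, hL], fun k m hkm _ => ?_⟩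
  simp only [hL, ratioProd_headTailWord, coe_perm1243_symm, exampleSponge_ratio]
  fin_cases k <;> fin_cases m <;> first
    | exact absurd hkm (by decide)
    | norm_num [exampleRatio] <;> decide

lemma perm2134_mem_cubeOrderings : perm2134 ∈ exampleSponge.cubeOrderings := by
  refine ⟨headTailWord 0 0, 0.7, by norm_num, by norm_num, ?_⟩
  have hL : ∀ n, exampleSponge.stopping (headTailWord 0 0) 0.7 n = 0 + 1 := fun n =>
    stopping_headTailWord_one _ _ _ _ (exampleSponge_ratio_le _ _) (by norm_num)
  refine ⟨fun a b _ => by rw [hL, hL], fun k m hkm _ => ?_⟩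
  simp only [hL, ratioProd_headTailWord, coe_perm2134_symm, exampleSponge_ratio]
  fin_cases k <;> fin_cases m <;> first
    | exact absurd hkm (by decide)
    | norm_num [exampleRatio] <;> decide

lemma one_mem_cubeOrderings : 1 ∈ exampleSponge.cubeOrderings := by
  -- Word and scale are chosen to make the four stoppings distinct, so the tie-break is vacuous.
  refine ⟨headTailWord 0 1, 0.05, by norm_num, by norm_num, ?_⟩
  have hL : exampleSponge.stopping (headTailWord 0 1) 0.05 = ![4, 3, 2, 1] := by
    funext n
    fin_cases n
    · exact stopping_headTailWord _ _ _ _ (K := 2) (by norm_num [exampleSponge_ratio, exampleRatio])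
        (by norm_num [exampleSponge_ratio, exampleRatio])
    · exact stopping_headTailWord _ _ _ _ (K := 1) (by norm_num [exampleSponge_ratio, exampleRatio])
        (by norm_num [exampleSponge_ratio, exampleRatio])
    · exact stopping_headTailWord _ _ _ _ (K := 0) (by norm_num [exampleSponge_ratio, exampleRatio])
        (by norm_num [exampleSponge_ratio, exampleRatio])
    · exact stopping_headTailWord_one _ _ _ _ (by norm_num [exampleSponge_ratio, exampleRatio])
        (by norm_num)
  refine ⟨fun a b hab => ?_, fun k m hkm he => ?_⟩
  · rw [hL]
    revert a b
    decide
  · rw [hL] at he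
    revert k m
    decide

lemma perm2143_mem_cubeOrderings : perm2143 ∈ exampleSponge.cubeOrderings := by
  -- The leading second map makes coordinate 3 stop before coordinate 4, with product exactly 0.1.
  -- The first map then takes over and, at length 3, makes the product in coordinate 2 (0.048)
  -- exceed that in coordinate 1 (0.024), which settles the only tie.
  refine ⟨headTailWord 1 0, 0.1, by norm_num, by norm_num, ?_⟩
  have hL : exampleSponge.stopping (headTailWord 1 0) 0.1 = ![3, 3, 1, 2] := by
    funext n
    fin_cases n
    · exact stopping_headTailWord _ _ _ _ (K := 1) (by norm_num [exampleSponge_ratio, exampleRatio])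
        (by norm_num [exampleSponge_ratio, exampleRatio])
    · exact stopping_headTailWord _ _ _ _ (K := 1) (by norm_num [exampleSponge_ratio, exampleRatio])
        (by norm_num [exampleSponge_ratio, exampleRatio])
    · exact stopping_headTailWord_one _ _ _ _ (by norm_num [exampleSponge_ratio, exampleRatio])
        (by norm_num)
    · exact stopping_headTailWord _ _ _ _ (K := 0) (by norm_num [exampleSponge_ratio, exampleRatio])
        (by norm_num [exampleSponge_ratio, exampleRatio])
  refine ⟨fun a b hab => ?_, fun k m hkm he => ?_⟩
  · rw [hL, coe_perm2143]
    revert a b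
    decide
  · rw [hL] at he ⊢
    obtain ⟨rfl, rfl⟩ : k = 0 ∧ m = 1 := by
      revert k m
      decide
    have h3 : (![3, 3, 1, 2] : Fin 4 → ℕ) 0 = 2 + 1 := rfl
    rw [h3, ratioProd_headTailWord, ratioProd_headTailWord, coe_perm2143_symm]
    norm_num [exampleSponge_ratio, exampleRatio]

lemma perm2143_notMem_cylinderOrderings : perm2143 ∉ exampleSponge.cylinderOrderings := by
  intro h
  rcases perm_mem_of_mem_cylinderOrderings h with h | h | h <;>
    exact absurd h (by decide)

/-! ### Strict inclusion and equality of the maxima -/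

lemma exampleSponge_cylinderOrderings_ssubset :
    exampleSponge.cylinderOrderings ⊂ exampleSponge.cubeOrderings := by
  refine (ssubset_iff_of_subset fun σ hσ => ?_).mpr
    ⟨perm2143, perm2143_mem_cubeOrderings, perm2143_notMem_cylinderOrderings⟩
  rcases perm_mem_of_mem_cylinderOrderings hσ with rfl | rfl | rfl
  · exact one_mem_cubeOrderings
  · exact perm1243_mem_cubeOrderings
  · exact perm2134_mem_cubeOrderings

lemma apply_zero_of_mem_cubeOrderings {σ : Equiv.Perm (Fin 4)}
    (hσ : σ ∈ exampleSponge.cubeOrderings) : σ 0 = 0 ∨ σ 0 = 1 := by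
  obtain ⟨w, r, hr, hr1, h⟩ := hσ
  have h2 := h.apply_zero_ne hr hr1 (k := 1) (m := 2) (by decide) exampleSponge_ratio_two_lt_one
  have h3 := h.apply_zero_ne hr hr1 (k := 1) (m := 3) (by decide) exampleSponge_ratio_three_lt_one
  generalize σ 0 = x at h2 h3 ⊢
  revert x
  decide

/-- Every value of `S̄(p, ·)` on the cube orderings is attained by a cylinder ordering. -/
lemma exampleSponge_image_upperS_eq {p : Fin 2 → ℝ} (hp : ∀ i, 0 < p i) (hp1 : ∑ i, p i = 1) :
    exampleSponge.upperS p '' exampleSponge.cubeOrderings =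
      exampleSponge.upperS p '' exampleSponge.cylinderOrderings := by
  refine Subset.antisymm ?_ (image_mono exampleSponge_cylinderOrderings_ssubset.subset)
  -- Without overlaps only the first coordinate of the ordering matters, so one cylinder ordering
  -- for each possible `σ 0` suffices.
  have heq : ∀ σ τ : Equiv.Perm (Fin 4), σ 0 = τ 0 →
      exampleSponge.upperS p σ = exampleSponge.upperS p τ := fun σ τ h => by
    rw [exampleSponge.upperS_eq_of_forall_not_overlap (exampleSponge_eq_of_overlap σ) hp hp1,
      exampleSponge.upperS_eq_of_forall_not_overlap (exampleSponge_eq_of_overlap τ) hp hp1, h]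
  rintro _ ⟨σ, hσ, rfl⟩
  rcases apply_zero_of_mem_cubeOrderings hσ with h | h
  · exact ⟨perm1243, perm1243_mem_cylinderOrderings, heq _ _ (by rw [h]; decide)⟩
  · exact ⟨perm2134, perm2134_mem_cylinderOrderings, heq _ _ (by rw [h]; decide)⟩

end Example

end Sponge

end

theorem proposition3p4 :
    ∃ S : Sponge 4 2,
      S.ratio 0 = ![0.2, 0.4, 0.08, 0.02] ∧
      S.ratio 1 = ![0.6, 0.3, 0.1, 0.2] ∧
      S.VeryStrongSPPC ∧
      S.cylinderOrderings ⊂ S.cubeOrderings ∧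
      ∀ p : Fin 2 → ℝ, (∀ i, 0 < p i) → ∑ i, p i = 1 →
        ∃ M : ℝ, IsGreatest (S.upperS p '' S.cylinderOrderings) M ∧
          IsGreatest (S.upperS p '' S.cubeOrderings) M := by
  refine ⟨Sponge.exampleSponge, rfl, rfl, Sponge.exampleSponge_veryStrongSPPC,
    Sponge.exampleSponge_cylinderOrderings_ssubset, fun p hp hp1 => ?_⟩
  rw [Sponge.exampleSponge_image_upperS_eq hp hp1]
  -- The two sets of values coincide and are finite and nonempty, so one maximum serves both.
  obtain ⟨M, hM⟩ := ((Set.toFinite (Sponge.exampleSponge.upperS p ''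
    Sponge.exampleSponge.cylinderOrderings)).isCompact).exists_isGreatest
      ⟨_, Set.mem_image_of_mem _ Sponge.perm1243_mem_cylinderOrderings⟩
  exact ⟨M, hM, hM⟩
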